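/- For $k\ge 1$ let $S_k$ be the symmetric group on $\{1,\dots,k\}$. Call two homomorphisms $f_1,f_2:G\to H$ conjugate if there is $h\in H$ with $f_1(x)=h f_2(x) h^{-1}$ for all $x\in G$, and let $\operatorname{Out}(G)=\operatorname{Aut}(G)/\operatorname{Inn}(G)$. Let $g:S_4\to S_3$ be the exceptional map, that is, the unique homomorphism with $g((1\,4))=(1\,2)$, $g((2\,4))=(1\,3)$ and $g((3\,4))=(2\,3)$, and let $\iota:S_3\to S_4$ be the standard inclusion (as the permutations fixing $4$). **Theorem (Hölder).** Let $n\ge m>2$ be integers and let $f:S_n\to S_m$ be a homomorphism. Then: 1. If $n>m$ and $(n,m)\ne(4,3)$, then $\operatorname{Im}(f)$ is cyclic. 2. If $n=m\notin\{4,6\}$ and $\operatorname{Im}(f)$ is non-cyclic, then $f$ is an inner automorphism. 3. If $n=m=6$ and $\operatorname{Im}(f)$ is non-cyclic, then $f$ is an automorphism. Furthermore, $\operatorname{Out}(S_6)\cong\mathbb{Z}/2\mathbb{Z}$. 4. If $(n,m)=(4,3)$ and $\operatorname{Im}(f)$ is non-cyclic, then $f$ is conjugate to $g$. 5. If $n=m=4$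 and $\operatorname{Im}(f)$ is non-cyclic, then $f$ is either an inner automorphism or conjugate to $\iota\circ g$. -/

import Mathlib

/-- The inner automorphisms form a normal subgroup of the automorphism group. -/
instance innNormal (G : Type*) [Group G] : (MulAut.conj (G := G)).range.Normal where
  conj_mem := by
    rintro _ ⟨g, rfl⟩ φ
    refine ⟨φ g, ?_⟩
    ext x
    simp [MulAut.conj_apply, MulAut.mul_apply]

/-- The outer automorphism group `Out(G) = Aut(G) / Inn(G)`. -/
abbrev Out (G : Type*) [Group G] : Type _ := MulAut G ⧸ (MulAut.conj (G := G)).range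

/-- An endomorphism of `G` is an inner automorphism if it is `x ↦ g x g⁻¹` for some `g : G`. -/
def IsInnerAut {G : Type*} [Group G] (f : G →* G) : Prop :=
  ∃ g : G, ∀ x : G, f x = g * x * g⁻¹

/-- Two homomorphisms `G → H` are conjugate if they differ by an inner automorphism of the
target `H`. -/
def IsConjHom {G H : Type*} [Group G] [Group H] (f₁ f₂ : G →* H) : Prop :=
  ∃ h : H, ∀ x : G, f₁ x = h * f₂ x * h⁻¹

/-- The label of the partition of `{0, 1, 2, 3}` into two pairs one of which is `{a, b}`:
`{0, 1}, {2, 3}` has label `0`, `{0, 2}, {1, 3}` has label `1`, and `{0, 3}, {1, 2}` has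
label `2` (the value for `a = b` is irrelevant). -/
def pairingLabel (a b : Fin 4) : Fin 3 :=
  if ({a, b} : Finset (Fin 4)) = {0, 1} ∨ ({a, b} : Finset (Fin 4)) = {2, 3} then 0
  else if ({a, b} : Finset (Fin 4)) = {0, 2} ∨ ({a, b} : Finset (Fin 4)) = {1, 3} then 1
  else 2

/-- The element that is paired with `3` in the partition with label `i`. -/
def partner (i : Fin 3) : Fin 4 := (Fin.rev i).castSucc

/-- The label of the image under `σ` of the partition with label `i`. -/
def pairingAct (σ : Equiv.Perm (Fin 4)) (i : Fin 3) : Fin 3 :=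
  pairingLabel (σ (partner i)) (σ 3)

theorem pairingLabel_perm : ∀ (σ : Equiv.Perm (Fin 4)) (a b : Fin 4), a ≠ b →
    pairingLabel (σ (partner (pairingLabel a b))) (σ 3) = pairingLabel (σ a) (σ b) := by
  decide +kernel

theorem pairingAct_mul (σ τ : Equiv.Perm (Fin 4)) (i : Fin 3) :
    pairingAct (σ * τ) i = pairingAct σ (pairingAct τ i) := by
  have h3 : ∀ j : Fin 3, partner j ≠ 3 := by decide
  have h : τ (partner i) ≠ τ 3 := fun h => h3 i (τ.injective h)
  exact (pairingLabel_perm σ _ _ h).symm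

theorem pairingAct_one (i : Fin 3) : pairingAct 1 i = i := by
  revert i
  decide

/-- The exceptional homomorphism `S₄ → S₃`: the action of `S₄` on the three partitions of
`{0, 1, 2, 3}` into two pairs. -/
def exceptionalHom : Equiv.Perm (Fin 4) →* Equiv.Perm (Fin 3) where
  toFun σ :=
    { toFun := pairingAct σ
      invFun := pairingAct σ⁻¹
      left_inv := fun i => by rw [← pairingAct_mul, inv_mul_cancel, pairingAct_one]
      right_inv := fun i => by rw [← pairingAct_mul, mul_inv_cancel, pairingAct_one] }
  map_one' := Equiv.ext pairingAct_one
  map_mul' σ τ := Equiv.ext (pairingAct_mul σ τ)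

theorem exists_star_word : ∀ σ : Equiv.Perm (Fin 4), ∃ a b c d : Fin 4,
    σ = Equiv.swap a 3 * Equiv.swap b 3 * Equiv.swap c 3 * Equiv.swap d 3 := by
  decide +kernel

/-- `exceptionalHom` is the unique homomorphism `g : S₄ → S₃` with `g(1 4) = (1 2)`,
`g(2 4) = (1 3)` and `g(3 4) = (2 3)`, where the points `1, 2, …` are written `0, 1, …`. -/
theorem eq_exceptionalHom_iff (g : Equiv.Perm (Fin 4) →* Equiv.Perm (Fin 3)) :
    g = exceptionalHom ↔
      g (Equiv.swap 0 3) = Equiv.swap 0 1 ∧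
      g (Equiv.swap 1 3) = Equiv.swap 0 2 ∧
      g (Equiv.swap 2 3) = Equiv.swap 1 2 := by
  have e0 : exceptionalHom (Equiv.swap 0 3) = Equiv.swap 0 1 := by decide +kernel
  have e1 : exceptionalHom (Equiv.swap 1 3) = Equiv.swap 0 2 := by decide +kernel
  have e2 : exceptionalHom (Equiv.swap 2 3) = Equiv.swap 1 2 := by decide +kernel
  constructor
  · rintro rfl
    exact ⟨e0, e1, e2⟩
  · rintro ⟨h0, h1, h2⟩
    have key : ∀ a : Fin 4, g (Equiv.swap a 3) = exceptionalHom (Equiv.swap a 3) := by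
      intro a
      fin_cases a
      · exact h0.trans e0.symm
      · exact h1.trans e1.symm
      · exact h2.trans e2.symm
      · have h : Equiv.swap (3 : Fin 4) 3 = 1 := Equiv.swap_self 3
        exact (congrArg g h).trans ((map_one g).trans
          ((map_one exceptionalHom).symm.trans (congrArg exceptionalHom h.symm)))
    refine MonoidHom.ext fun σ => ?_
    obtain ⟨a, b, c, d, rfl⟩ := exists_star_word σ
    simp only [map_mul, key]

/-- The standard inclusion `S₃ → S₄`, extending a permutation of the first three points so that
it fixes the last point. -/
noncomputable def inclS3S4 : Equiv.Perm (Fin 3) →* Equiv.Perm (Fin 4) :=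
  Equiv.Perm.viaEmbeddingHom Fin.castSuccEmb

/-! For `n ≥ 5` a nontrivial normal subgroup of `S_n` contains `A_n`, so a non-cyclic image forces
injectivity; comparing `n!` with `m!` settles `n > m`, and for `n = m` the map is an automorphism.

An automorphism preserves orders of centralizers. For cycle type `2 ^ k` this order is `(n - 2k)!
2^k k!`, which equals its value at `k = 1` only for `k = 1` or `(n, k) = (6, 3)`. So transpositions
go to transpositions unless `n = 6`. An injective endomorphism preserving transpositions is inner:
the star of transpositions through `a` goes to a star through some `φ a`, and the map is conjugation
by `φ`.

For `n = 6`, the action of `S_5` on its six Sylow 5-subgroups gives a transitive subgroup of index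
6, and the action of `S_6` on its cosets is an outer automorphism. Any two outer automorphisms send
transpositions to the same class, so they differ by an inner one.

Degrees 3 and 4 are a finite check on images of star transpositions, constrained by the relations
these satisfy. -/

open Equiv Equiv.Perm

/-! ### Endomorphisms preserving transpositions -/

/-- Two transpositions that do not commute have exactly one point in common. -/
theorem IsSwap.exists_common_point {α : Type*} [DecidableEq α] {s t : Perm α}
    (hs : s.IsSwap) (ht : t.IsSwap) (hst : s * t ≠ t * s) :
    ∃ x y z, x ≠ y ∧ x ≠ z ∧ y ≠ z ∧ s = swap x y ∧ t = swap x z := by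
  obtain ⟨a, b, hab, rfl⟩ := hs
  obtain ⟨c, d, hcd, rfl⟩ := ht
  by_cases hac : a = c
  · subst hac
    refine ⟨a, b, d, hab, hcd, ?_, rfl, rfl⟩
    rintro rfl; exact hst rfl
  by_cases had : a = d
  · subst had
    refine ⟨a, b, c, hab, hac, ?_, rfl, swap_comm _ _⟩
    rintro rfl; exact hst (by rw [swap_comm])
  by_cases hbc : b = c
  · subst hbc
    exact ⟨b, a, d, hab.symm, hcd, had, swap_comm _ _, rfl⟩
  by_cases hbd : b = d
  · subst hbd
    exact ⟨b, a, c, hab.symm, hcd.symm, hac, swap_comm _ _, swap_comm _ _⟩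
  refine absurd ?_ hst
  have hdis : Disjoint (swap a b) (swap c d) := by
    intro x
    by_cases hxa : x = a
    · subst hxa; right; exact swap_apply_of_ne_of_ne hac had
    by_cases hxb : x = b
    · subst hxb; right; exact swap_apply_of_ne_of_ne hbc hbd
    left; exact swap_apply_of_ne_of_ne hxa hxb
  exact hdis.commute

theorem swap_mul_swap_ne_swap_mul_swap {α : Type*} [DecidableEq α] {a b c : α}
    (hab : a ≠ b) (hac : a ≠ c) (hbc : b ≠ c) :
    swap a b * swap a c ≠ swap a c * swap a b := by
  intro h
  have := congrArg (fun σ : Perm α => σ a) h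
  simp only [Perm.mul_apply, swap_apply_left] at this
  rw [swap_apply_of_ne_of_ne hac.symm hbc.symm, swap_apply_of_ne_of_ne hab.symm hbc] at this
  exact hbc this.symm

theorem swap_conj_swap {α : Type*} [DecidableEq α] {a b c : α}
    (hac : a ≠ c) (hbc : b ≠ c) :
    swap a b * swap a c * swap a b = swap b c := by
  have h := Equiv.swap_apply_apply (swap a b) a c
  rw [swap_apply_left, swap_apply_of_ne_of_ne hac.symm hbc.symm, swap_inv] at h
  exact h.symm

theorem exists_ne_ne_of_three_le_card {α : Type*} [Fintype α] [DecidableEq α]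
    (h3 : 3 ≤ Fintype.card α) (a : α) : ∃ b c, a ≠ b ∧ a ≠ c ∧ b ≠ c := by
  have h : 1 < (Finset.univ.erase a).card := by
    rw [Finset.card_erase_of_mem (Finset.mem_univ a), Finset.card_univ]; omega
  obtain ⟨b, hb, c, hc, hbc⟩ := Finset.one_lt_card.mp h
  exact ⟨b, c, (Finset.ne_of_mem_erase hb).symm, (Finset.ne_of_mem_erase hc).symm, hbc⟩

/-- The images of the transpositions `(a b)` with `a` fixed all move a common point. -/
theorem exists_point_moved_by_map_swap {α : Type*} [Fintype α] [DecidableEq α]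
    (h3 : 3 ≤ Fintype.card α) {f : Perm α →* Perm α} (hf : Function.Injective f)
    (hs : ∀ s : Perm α, s.IsSwap → (f s).IsSwap) (a : α) :
    ∃ x, ∀ b, a ≠ b → f (swap a b) x ≠ x := by
  have hnc : ∀ {b c : α}, a ≠ b → a ≠ c → b ≠ c →
      f (swap a b) * f (swap a c) ≠ f (swap a c) * f (swap a b) := by
    intro b c hab hac hbc h
    rw [← map_mul, ← map_mul] at h
    exact swap_mul_swap_ne_swap_mul_swap hab hac hbc (hf h)
  obtain ⟨b, c, hab, hac, hbc⟩ := exists_ne_ne_of_three_le_card h3 a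
  obtain ⟨x, y, z, hxy, hxz, hyz, hb, hc⟩ := IsSwap.exists_common_point
    (hs _ ⟨a, b, hab, rfl⟩) (hs _ ⟨a, c, hac, rfl⟩) (hnc hab hac hbc)
  refine ⟨x, fun d had hd => ?_⟩
  by_cases hdb : d = b
  · subst hdb
    rw [hb, swap_apply_left] at hd
    exact hxy hd.symm
  by_cases hdc : d = c
  · subst hdc
    rw [hc, swap_apply_left] at hd
    exact hxz hd.symm
  -- If the image of `(a d)` fixed both `x` and `w`, it would be disjoint from `(x w)` and commute
  -- with it. Hence it moves `y` and `z`, so it is `(y z)`, already the image of `(b c)`.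
  have hmove : ∀ {e w : α}, a ≠ e → d ≠ e → x ≠ w → f (swap a e) = swap x w →
      f (swap a d) w ≠ w := by
    intro e w hae hde hxw he hw
    apply hnc had hae hde
    rw [he]
    refine Perm.Disjoint.commute fun u => ?_
    by_cases hux : u = x
    · subst hux; exact Or.inl hd
    by_cases huw : u = w
    · subst huw; exact Or.inl hw
    exact Or.inr (swap_apply_of_ne_of_ne hux huw)
  have hy := hmove hab hdb hxy hb
  have hz := hmove hac hdc hxz hc
  have hyz' : f (swap a d) = swap y z := by
    obtain ⟨u, v, huv, huv'⟩ := hs _ ⟨a, d, had, rfl⟩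
    rw [huv'] at hy hz ⊢
    have hy' := (swap_apply_ne_self_iff.mp hy).2
    have hz' := (swap_apply_ne_self_iff.mp hz).2
    rcases hy' with rfl | rfl <;> rcases hz' with rfl | rfl
    · exact absurd rfl hyz
    · rfl
    · exact swap_comm _ _
    · exact absurd rfl hyz
  have hbc' : f (swap b c) = swap y z := by
    rw [← swap_conj_swap hac hbc, map_mul, map_mul, hb, hc, swap_conj_swap hxz hyz]
  have := hf (hyz'.trans hbc'.symm)
  have := congrArg (fun σ : Perm α => σ a) this
  simp only [swap_apply_left] at this
  rw [swap_apply_of_ne_of_ne hab hac] at this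
  exact had this.symm

/-- Injective endomorphisms of a symmetric group that preserve transpositions are inner. -/
theorem isInnerAut_of_isSwap_map {α : Type*} [Fintype α] [DecidableEq α]
    (h3 : 3 ≤ Fintype.card α) {f : Perm α →* Perm α} (hf : Function.Injective f)
    (hs : ∀ s : Perm α, s.IsSwap → (f s).IsSwap) : IsInnerAut f := by
  choose φ hφ using exists_point_moved_by_map_swap h3 hf hs
  have hinj : Function.Injective φ := by
    intro a b hab
    by_contra hne
    -- The images of `(a b)`, `(a c)`, `(b c)` would all move `φ a = φ b`, but they are the three
    -- sides of a triangle and share no point.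
    obtain ⟨c, hac, hbc⟩ : ∃ c, a ≠ c ∧ b ≠ c := by
      obtain ⟨c, d, hac, had, hcd⟩ := exists_ne_ne_of_three_le_card h3 a
      by_cases hbc : b = c
      · exact ⟨d, had, hbc ▸ hcd⟩
      · exact ⟨c, hac, hbc⟩
    have h1 := hφ a b hne
    have h2 := hφ a c hac
    have h3' := hφ b c hbc
    rw [← hab, ← swap_conj_swap hac hbc, map_mul, map_mul] at h3'
    have hnc : f (swap a b) * f (swap a c) ≠ f (swap a c) * f (swap a b) := by
      rw [← map_mul, ← map_mul]
      exact fun h => swap_mul_swap_ne_swap_mul_swap hne hac hbc (hf h)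
    obtain ⟨x, y, z, hxy, hxz, hyz, hb, hc⟩ := IsSwap.exists_common_point
      (hs _ ⟨a, b, hne, rfl⟩) (hs _ ⟨a, c, hac, rfl⟩) hnc
    rw [hb, hc, swap_conj_swap hxz hyz] at h3'
    rw [hb] at h1
    rw [hc] at h2
    have e1 := (swap_apply_ne_self_iff.mp h1).2
    have e2 := (swap_apply_ne_self_iff.mp h2).2
    have e3 := (swap_apply_ne_self_iff.mp h3').2
    grind
  let g : Perm α := Equiv.ofBijective φ (Finite.injective_iff_bijective.mp hinj)
  refine ⟨g, fun σ => ?_⟩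
  have hswap : ∀ a b, a ≠ b → f (swap a b) = swap (φ a) (φ b) := by
    intro a b hab
    have h1 := hφ a b hab
    have h2 := hφ b a hab.symm
    rw [swap_comm] at h2
    obtain ⟨u, v, huv, huv'⟩ := hs _ ⟨a, b, hab, rfl⟩
    rw [huv'] at h1 h2 ⊢
    have e1 := (swap_apply_ne_self_iff.mp h1).2
    have e2 := (swap_apply_ne_self_iff.mp h2).2
    have hne : φ a ≠ φ b := hinj.ne hab
    rcases e1 with e1 | e1 <;> rcases e2 with e2 | e2
    · exact absurd (e1.trans e2.symm) hne
    · rw [e1, e2]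
    · rw [e1, e2, swap_comm]
    · exact absurd (e1.trans e2.symm) hne
  have heq : f = (MulAut.conj g).toMonoidHom := by
    refine MonoidHom.eq_of_eqOn_dense (Perm.closure_isSwap (α := α)) ?_
    rintro _ ⟨a, b, hab, rfl⟩
    rw [hswap a b hab]
    exact Equiv.swap_apply_apply g a b
  rw [heq]
  rfl

/-! ### Classes of involutions, told apart by centralizers -/

/-- The bound fails for `k = 2`, and `k = 3` gives the equality `24 = 4!` behind the exception in
`S_6`. -/
theorem two_pow_mul_factorial_lt_factorial {k : ℕ} (hk : 4 ≤ k) :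
    2 ^ (k - 1) * k.factorial < (2 * k - 2).factorial := by
  induction k, hk using Nat.le_induction with
  | base => decide
  | succ k hk ih =>
    obtain ⟨j, rfl⟩ : ∃ j, k = j + 1 := ⟨k - 1, by omega⟩
    have e : 2 * (j + 1 + 1) - 2 = (2 * (j + 1) - 2) + 1 + 1 := by omega
    rw [e, Nat.factorial_succ, Nat.factorial_succ, Nat.factorial_succ]
    simp only [Nat.add_sub_cancel] at ih ⊢
    rw [pow_succ]
    have h2 : 2 * (j + 2) ≤ (2 * (j + 1) - 2 + 1 + 1) * (2 * (j + 1) - 2 + 1) := by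
      have : 2 * (j + 1) - 2 = 2 * j := by omega
      rw [this]; nlinarith
    calc 2 ^ j * 2 * ((j + 1 + 1) * (j + 1).factorial)
        = 2 * (j + 2) * (2 ^ j * (j + 1).factorial) := by ring
      _ < 2 * (j + 2) * (2 * (j + 1) - 2).factorial := by gcongr
      _ ≤ (2 * (j + 1) - 2 + 1 + 1) * (2 * (j + 1) - 2 + 1) * (2 * (j + 1) - 2).factorial := by
        gcongr
      _ = _ := by rw [mul_assoc, ← Nat.factorial_succ]

/-- Numerical form of: for `(n, k) ≠ (6, 3)`, the permutations of cycle type `2 ^ k` with `k ≥ 2`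
are not as many as the transpositions. -/
theorem factorial_ne_of_involution_type {n k : ℕ} (hn : 5 ≤ n) (hk : 2 ≤ k) (hkn : 2 * k ≤ n)
    (h63 : ¬ (n = 6 ∧ k = 3)) :
    (n - 2 * k).factorial * 2 ^ k * k.factorial ≠ (n - 2).factorial * 2 := by
  apply Nat.ne_of_lt
  have hd : (n - 2).factorial = (n - 2 * k).factorial * (n - 2).descFactorial (2 * k - 2) := by
    rw [← Nat.factorial_mul_descFactorial (show 2 * k - 2 ≤ n - 2 by omega)]
    congr 2; omega
  have hlt : 2 ^ (k - 1) * k.factorial < (n - 2).descFactorial (2 * k - 2) := by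
    -- For `k = 2, 3` the factorial `(2k - 2)!` is too small; `n ≥ 5`, respectively `n ≥ 7`, allows
    -- `n - 2` to be replaced by 3, respectively 5.
    rcases (show k = 2 ∨ k = 3 ∨ 4 ≤ k by omega) with rfl | rfl | h4
    · calc _ < Nat.descFactorial 3 2 := by decide
        _ ≤ _ := Nat.descFactorial_le _ (by omega)
    · calc _ < Nat.descFactorial 5 4 := by decide
        _ ≤ _ := Nat.descFactorial_le _ (by omega)
    · calc _ < (2 * k - 2).factorial := two_pow_mul_factorial_lt_factorial h4
        _ = (2 * k - 2).descFactorial (2 * k - 2) := (Nat.descFactorial_self _).symm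
        _ ≤ _ := Nat.descFactorial_le _ (by omega)
  have e : 2 ^ k = 2 ^ (k - 1) * 2 := by rw [← pow_succ]; congr 1; omega
  rw [hd, e]
  calc _ = (n - 2 * k).factorial * (2 ^ (k - 1) * k.factorial) * 2 := by ring
    _ < _ := by
      have := Nat.factorial_pos (n - 2 * k)
      gcongr

theorem card_centralizer_of_cycleType_replicate_two {α : Type*} [Fintype α] [DecidableEq α]
    {σ : Perm α} {k : ℕ} (hk : k ≠ 0) (hσ : σ.cycleType = Multiset.replicate k 2) :
    Nat.card (Subgroup.centralizer {σ}) =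
      (Fintype.card α - 2 * k).factorial * 2 ^ k * k.factorial := by
  rw [Perm.nat_card_centralizer, hσ, Multiset.sum_replicate, Multiset.prod_replicate,
    Multiset.toFinset_replicate, if_neg hk, Finset.prod_singleton, Multiset.count_replicate_self,
    smul_eq_mul, mul_comm k 2]

theorem card_centralizer_map {G H : Type*} [Group G] [Group H] (e : G ≃* H) (x : G) :
    Nat.card (Subgroup.centralizer {e x}) = Nat.card (Subgroup.centralizer {x}) := by
  refine Nat.card_congr (e.symm.toEquiv.subtypeEquiv fun y => ?_)
  simp only [Subgroup.mem_centralizer_singleton_iff]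
  constructor
  · intro h
    have := congrArg e.symm h
    simpa using this
  · intro h
    apply e.symm.injective
    simpa using h

/-- An automorphism of `S_n` with `n ≥ 5` sends transpositions to transpositions, or `n = 6` and
it sends them to products of three disjoint transpositions. -/
theorem cycleType_mulAut_swap {α : Type*} [Fintype α] [DecidableEq α] (h5 : 5 ≤ Fintype.card α)
    (e : MulAut (Perm α)) {s : Perm α} (hs : s.IsSwap) :
    (e s).IsSwap ∨ (Fintype.card α = 6 ∧ (e s).cycleType = Multiset.replicate 3 2) := by
  have ho : orderOf (e s) = 2 := by rw [MulEquiv.orderOf_eq]; exact hs.orderOf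
  obtain ⟨j, hj⟩ := cycleType_prime_order (σ := e s) (ho ▸ Nat.prime_two)
  rw [ho] at hj
  have hle : 2 * (j + 1) ≤ Fintype.card α := by
    have := (e s).support.card_le_univ
    rw [← sum_cycleType, hj, Multiset.sum_replicate, smul_eq_mul] at this
    omega
  have h1 := card_centralizer_of_cycleType_replicate_two (Nat.succ_ne_zero j) hj
  have h2 := card_centralizer_of_cycleType_replicate_two (k := 1) one_ne_zero
    (σ := s) (by rw [isSwap_iff_cycleType.mp hs]; rfl)
  rw [card_centralizer_map, h2] at h1
  simp only [mul_one, pow_one, Nat.factorial_one] at h1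
  rcases Nat.eq_zero_or_pos j with rfl | hjpos
  · left
    rw [isSwap_iff_cycleType, hj]; rfl
  · right
    by_contra hcon
    refine factorial_ne_of_involution_type h5 (k := j + 1) (by omega) hle ?_ h1.symm
    rintro ⟨h6, h3⟩
    exact hcon ⟨h6, by rw [hj, h3]⟩

/-! ### Kernels and non-cyclic images -/

/-- A homomorphism from `S_n`, `n ≥ 5`, with non-cyclic image is injective. -/
theorem injective_of_not_isCyclic_range {α H : Type*} [Fintype α] [DecidableEq α] [Group H]
    (h5 : 5 ≤ Fintype.card α) (f : Perm α →* H) (hf : ¬ IsCyclic f.range) :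
    Function.Injective f := by
  rw [← MonoidHom.ker_eq_bot_iff]
  by_contra hne
  have hle := alternatingGroup_le_of_normal (by rwa [Nat.card_eq_fintype_card])
    ((Subgroup.nontrivial_iff_ne_bot _).mpr hne)
  have : Nontrivial α := Fintype.one_lt_card_iff_nontrivial.mp (by omega)
  have hdvd : Nat.card f.range ∣ 2 := by
    rw [← Subgroup.index_ker, ← alternatingGroup.index_eq_two (α := α)]
    exact Subgroup.index_dvd_of_le hle
  apply hf
  rcases (Nat.dvd_prime Nat.prime_two).mp hdvd with h | h
  · have := (Nat.card_eq_one_iff_unique.mp h).1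
    infer_instance
  · exact isCyclic_of_prime_card h

theorem isCyclic_range_of_forall_mem_zpowers {G H : Type*} [Group G] [Group H] {f : G →* H}
    (x : H) (h : ∀ g, f g ∈ Subgroup.zpowers x) : IsCyclic f.range :=
  Subgroup.isCyclic_of_le (H' := Subgroup.zpowers x) (by rintro _ ⟨g, rfl⟩; exact h g)

/-! ### Degrees three and four -/

/-- Shorter words are padded with the trivial letter `swap 2 2`. -/
theorem exists_star_word_three : ∀ σ : Perm (Fin 3), ∃ a b c : Fin 3,
    σ = swap a 2 * swap b 2 * swap c 2 := by
  decide +kernel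

theorem hom_ext_star_three {H : Type*} [Group H] {f g : Perm (Fin 3) →* H}
    (h : ∀ a, f (swap a 2) = g (swap a 2)) : f = g := by
  refine MonoidHom.ext fun σ => ?_
  obtain ⟨a, b, c, rfl⟩ := exists_star_word_three σ
  simp only [map_mul, h]

theorem hom_ext_star_four {H : Type*} [Group H] {f g : Perm (Fin 4) →* H}
    (h : ∀ a, f (swap a 3) = g (swap a 3)) : f = g := by
  refine MonoidHom.ext fun σ => ?_
  obtain ⟨a, b, c, d, rfl⟩ := exists_star_word σ
  simp only [map_mul, h]

set_option synthInstance.maxSize 1000 in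
set_option synthInstance.maxHeartbeats 200000 in
theorem involution_pairs_three : ∀ x : Perm (Fin 3), x * x = 1 → ∀ y : Perm (Fin 3), y * y = 1 →
    x * y * x = y * x * y → x = y ∨ ∃ h : Perm (Fin 3),
      x = h * swap 0 2 * h⁻¹ ∧ y = h * swap 1 2 * h⁻¹ := by
  decide +kernel

-- The relations are those of `(1 4)`, `(2 4)`, `(3 4)`: a braid relation for each pair, and `(1 4)`
-- commutes with `(2 4)(3 4)(2 4) = (2 3)`. Each is imposed as soon as its variables are bound, to
-- prune the search.
set_option synthInstance.maxSize 1000 in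
set_option synthInstance.maxHeartbeats 200000 in
theorem involution_triples_three : ∀ x : Perm (Fin 3), x * x = 1 →
    ∀ y : Perm (Fin 3), y * y = 1 → x * y * x = y * x * y →
    ∀ z : Perm (Fin 3), z * z = 1 → x * z * x = z * x * z → y * z * y = z * y * z →
    x * (y * z * y) = (y * z * y) * x →
    (x = y ∧ x = z) ∨ ∃ h : Perm (Fin 3),
      x = h * swap 0 1 * h⁻¹ ∧ y = h * swap 0 2 * h⁻¹ ∧ z = h * swap 1 2 * h⁻¹ := by
  decide +kernel

set_option synthInstance.maxSize 1000 in
set_option synthInstance.maxHeartbeats 200000 in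
theorem involution_triples_four : ∀ x : Perm (Fin 4), x * x = 1 →
    ∀ y : Perm (Fin 4), y * y = 1 → x * y * x = y * x * y →
    ∀ z : Perm (Fin 4), z * z = 1 → x * z * x = z * x * z → y * z * y = z * y * z →
    x * (y * z * y) = (y * z * y) * x →
    (x = y ∧ x = z) ∨ (∃ h : Perm (Fin 4),
      x = h * swap 0 3 * h⁻¹ ∧ y = h * swap 1 3 * h⁻¹ ∧ z = h * swap 2 3 * h⁻¹) ∨
    ∃ h : Perm (Fin 4),
      x = h * swap 0 1 * h⁻¹ ∧ y = h * swap 0 2 * h⁻¹ ∧ z = h * swap 1 2 * h⁻¹ := by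
  decide +kernel

theorem map_swap_self {α H : Type*} [DecidableEq α] [Group H] (f : Perm α →* H) (a : α) :
    f (swap a a) = 1 := by
  rw [swap_self]; exact map_one f

theorem hom_perm_three {f : Perm (Fin 3) →* Perm (Fin 3)} (hf : ¬ IsCyclic f.range) :
    IsInnerAut f := by
  have h := involution_pairs_three (f (swap 0 2)) (by rw [← map_mul, swap_mul_self, map_one])
    (f (swap 1 2)) (by rw [← map_mul, swap_mul_self, map_one])
    (by simp only [← map_mul]; exact congrArg f (by decide))
  rcases h with h | ⟨h, h0, h1⟩
  · refine absurd (isCyclic_range_of_forall_mem_zpowers (f (swap 0 2)) fun σ => ?_) hf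
    have key : ∀ a : Fin 3, f (swap a 2) ∈ Subgroup.zpowers (f (swap 0 2)) := by
      intro a
      fin_cases a
      · exact Subgroup.mem_zpowers _
      · exact h ▸ Subgroup.mem_zpowers _
      · exact (map_swap_self f 2) ▸ one_mem _
    obtain ⟨a, b, c, rfl⟩ := exists_star_word_three σ
    simp only [map_mul]
    exact mul_mem (mul_mem (key a) (key b)) (key c)
  · refine ⟨h, DFunLike.congr_fun (?_ : f = (MulAut.conj h).toMonoidHom)⟩
    refine hom_ext_star_three fun a => ?_
    fin_cases a
    · exact h0
    · exact h1
    · exact (map_swap_self f 2).trans (map_swap_self _ 2).symm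

theorem isCyclic_range_of_map_star_eq {H : Type*} [Group H] {f : Perm (Fin 4) →* H}
    (h1 : f (swap 0 3) = f (swap 1 3)) (h2 : f (swap 0 3) = f (swap 2 3)) :
    IsCyclic f.range := by
  refine isCyclic_range_of_forall_mem_zpowers (f (swap 0 3)) fun σ => ?_
  have key : ∀ a : Fin 4, f (swap a 3) ∈ Subgroup.zpowers (f (swap 0 3)) := by
    intro a
    fin_cases a
    · exact Subgroup.mem_zpowers _
    · exact h1 ▸ Subgroup.mem_zpowers _
    · exact h2 ▸ Subgroup.mem_zpowers _
    · exact (map_swap_self f 3) ▸ one_mem _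
  obtain ⟨a, b, c, d, rfl⟩ := exists_star_word σ
  simp only [map_mul]
  exact mul_mem (mul_mem (mul_mem (key a) (key b)) (key c)) (key d)

theorem isConjHom_of_star {H : Type*} [Group H] {f g : Perm (Fin 4) →* H} (h : H)
    (h0 : f (swap 0 3) = h * g (swap 0 3) * h⁻¹) (h1 : f (swap 1 3) = h * g (swap 1 3) * h⁻¹)
    (h2 : f (swap 2 3) = h * g (swap 2 3) * h⁻¹) : IsConjHom f g := by
  refine ⟨h, DFunLike.congr_fun (?_ : f = (MulAut.conj h).toMonoidHom.comp g)⟩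
  refine hom_ext_star_four fun a => ?_
  fin_cases a
  · exact h0
  · exact h1
  · exact h2
  · exact (map_swap_self f 3).trans (map_swap_self _ 3).symm

theorem hom_perm_four_three {f : Perm (Fin 4) →* Perm (Fin 3)} (hf : ¬ IsCyclic f.range) :
    IsConjHom f exceptionalHom := by
  obtain ⟨g0, g1, g2⟩ := (eq_exceptionalHom_iff exceptionalHom).mp rfl
  have h := involution_triples_three
    (f (swap 0 3)) (by rw [← map_mul, swap_mul_self, map_one])
    (f (swap 1 3)) (by rw [← map_mul, swap_mul_self, map_one])
    (by simp only [← map_mul]; exact congrArg f (by decide))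
    (f (swap 2 3)) (by rw [← map_mul, swap_mul_self, map_one])
    (by simp only [← map_mul]; exact congrArg f (by decide))
    (by simp only [← map_mul]; exact congrArg f (by decide))
    (by simp only [← map_mul]; exact congrArg f (by decide))
  rcases h with ⟨h1, h2⟩ | ⟨h, h0, h1, h2⟩
  · exact absurd (isCyclic_range_of_map_star_eq h1 h2) hf
  · exact isConjHom_of_star h (by rw [g0, h0]) (by rw [g1, h1]) (by rw [g2, h2])

theorem inclS3S4_swap (a b : Fin 3) :
    inclS3S4 (swap a b) = swap a.castSucc b.castSucc := by
  refine Equiv.ext fun i => ?_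
  change (swap a b).viaEmbedding Fin.castSuccEmb i = _
  induction i using Fin.lastCases with
  | last =>
    rw [viaEmbedding_apply_of_notMem,
      swap_apply_of_ne_of_ne (Fin.castSucc_lt_last a).ne' (Fin.castSucc_lt_last b).ne']
    rintro ⟨j, hj⟩
    exact (Fin.castSucc_lt_last j).ne hj
  | cast i =>
    refine (viaEmbedding_apply _ _ i).trans ?_
    exact ((Fin.castSucc_injective 3).swap_apply a b i).symm

theorem hom_perm_four_four {f : Perm (Fin 4) →* Perm (Fin 4)} (hf : ¬ IsCyclic f.range) :
    IsInnerAut f ∨ IsConjHom f (inclS3S4.comp exceptionalHom) := by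
  obtain ⟨g0, g1, g2⟩ := (eq_exceptionalHom_iff exceptionalHom).mp rfl
  have h := involution_triples_four
    (f (swap 0 3)) (by rw [← map_mul, swap_mul_self, map_one])
    (f (swap 1 3)) (by rw [← map_mul, swap_mul_self, map_one])
    (by simp only [← map_mul]; exact congrArg f (by decide))
    (f (swap 2 3)) (by rw [← map_mul, swap_mul_self, map_one])
    (by simp only [← map_mul]; exact congrArg f (by decide))
    (by simp only [← map_mul]; exact congrArg f (by decide))
    (by simp only [← map_mul]; exact congrArg f (by decide))
  rcases h with ⟨h1, h2⟩ | ⟨h, h0, h1, h2⟩ | ⟨h, h0, h1, h2⟩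
  · exact absurd (isCyclic_range_of_map_star_eq h1 h2) hf
  · exact Or.inl (isConjHom_of_star (g := MonoidHom.id _) h h0 h1 h2)
  · refine Or.inr (isConjHom_of_star h ?_ ?_ ?_)
    · rw [MonoidHom.comp_apply, g0, inclS3S4_swap, h0]; rfl
    · rw [MonoidHom.comp_apply, g1, inclS3S4_swap, h1]; rfl
    · rw [MonoidHom.comp_apply, g2, inclS3S4_swap, h2]; rfl

/-! ### An outer automorphism of `S_6` -/

/-- A transitive action of `S_n`, `n ≥ 5`, on at least three points is faithful. -/
theorem toPermHom_injective_of_isPretransitive {α X : Type*} [Fintype α] [DecidableEq α]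
    (h5 : 5 ≤ Fintype.card α) [MulAction (Perm α) X] [MulAction.IsPretransitive (Perm α) X]
    (hX : 2 < Nat.card X) : Function.Injective (MulAction.toPermHom (Perm α) X) := by
  rw [← MonoidHom.ker_eq_bot_iff]
  by_contra hne
  have hle := alternatingGroup_le_of_normal (by rwa [Nat.card_eq_fintype_card])
    ((Subgroup.nontrivial_iff_ne_bot _).mpr hne)
  have : Nontrivial α := Fintype.one_lt_card_iff_nontrivial.mp (by omega)
  obtain ⟨x⟩ : Nonempty X := (Nat.card_pos_iff.mp (by omega)).1
  -- A point stabilizer containing `A_n` has index at most 2, too small for the orbit.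
  have hst : alternatingGroup α ≤ MulAction.stabilizer (Perm α) x := by
    intro g hg
    have := hle hg
    rw [MonoidHom.mem_ker] at this
    exact congrArg (fun σ : Perm X => σ x) this
  have hdvd := Subgroup.index_dvd_of_le hst
  rw [MulAction.index_stabilizer_of_transitive, alternatingGroup.index_eq_two] at hdvd
  have := Nat.le_of_dvd two_pos hdvd
  omega

/-- The number divides 24 and is 1 modulo 5, so it is 1 or 6. A unique Sylow 5-subgroup would be
normal and contain `A_5`, but its index is 24. -/
theorem card_sylow_five_perm_five : Nat.card (Sylow 5 (Perm (Fin 5))) = 6 := by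
  have : Fact (Nat.Prime 5) := ⟨by norm_num⟩
  obtain ⟨P⟩ : Nonempty (Sylow 5 (Perm (Fin 5))) := inferInstance
  have hcard : Nat.card (Perm (Fin 5)) = 120 := by
    rw [Nat.card_perm, Nat.card_fin]; rfl
  have hP : Nat.card P = 5 := by
    rw [P.card_eq_multiplicity, hcard]
    have : Nat.factorization 120 5 = 1 := by
      rw [show 120 = 5 ^ 1 * 24 by norm_num,
        Nat.factorization_eq_of_coprime_left (by norm_num) (by
          simp [Nat.primeFactorsList_prime (show Nat.Prime 5 by norm_num)])]
      simp [Nat.Prime.factorization_self (show Nat.Prime 5 by norm_num)]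
    rw [this, pow_one]
  have hidx : (P : Subgroup (Perm (Fin 5))).index = 24 := by
    have := (P : Subgroup (Perm (Fin 5))).card_mul_index
    rw [hcard] at this
    have hP' : Nat.card (P : Subgroup (Perm (Fin 5))) = 5 := hP
    rw [hP'] at this
    omega
  have hdvd : Nat.card (Sylow 5 (Perm (Fin 5))) ∣ 24 := hidx ▸ P.card_dvd_index
  have hmod := card_sylow_modEq_one 5 (Perm (Fin 5))
  have hle := Nat.le_of_dvd (by norm_num) hdvd
  have hne : Nat.card (Sylow 5 (Perm (Fin 5))) ≠ 1 := by
    intro h1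
    have hsub := (Nat.card_eq_one_iff_unique.mp h1).1
    have hn : (P : Subgroup (Perm (Fin 5))).Normal := Sylow.normal_of_subsingleton P
    have hA := alternatingGroup_le_of_normal (α := Fin 5) (by simp)
      (N := (P : Subgroup (Perm (Fin 5)))) (by
        apply Finite.one_lt_card_iff_nontrivial.mp
        exact lt_of_lt_of_eq (by norm_num) hP.symm)
    have := Subgroup.index_dvd_of_le hA
    rw [hidx, alternatingGroup.index_eq_two] at this
    norm_num at this
  generalize Nat.card (Sylow 5 (Perm (Fin 5))) = k at *
  unfold Nat.ModEq at hmod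
  interval_cases k <;> omega

/-- `S_6` contains a subgroup of index 6 that acts transitively, namely the image of `S_5` acting
on its Sylow 5-subgroups. -/
theorem exists_transitive_subgroup_index_six :
    ∃ H : Subgroup (Perm (Fin 6)), H.index = 6 ∧ ∀ i j : Fin 6, ∃ σ ∈ H, σ i = j := by
  have : Fact (Nat.Prime 5) := ⟨by norm_num⟩
  have h6 := card_sylow_five_perm_five
  let e : Sylow 5 (Perm (Fin 5)) ≃ Fin 6 := Finite.equivFinOfCardEq h6
  let φ : Perm (Fin 5) →* Perm (Fin 6) :=
    e.permCongrHom.toMonoidHom.comp (MulAction.toPermHom (Perm (Fin 5)) (Sylow 5 (Perm (Fin 5))))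
  have hφ : Function.Injective φ := e.permCongrHom.injective.comp
    (toPermHom_injective_of_isPretransitive (by simp) (by omega))
  refine ⟨φ.range, ?_, fun i j => ?_⟩
  · have h := φ.range.card_mul_index
    rw [← Nat.card_congr (MonoidHom.ofInjective hφ).toEquiv, Nat.card_perm, Nat.card_perm,
      Nat.card_fin, Nat.card_fin, show Nat.factorial 6 = Nat.factorial 5 * 6 by rfl] at h
    exact Nat.eq_of_mul_eq_mul_left (Nat.factorial_pos 5) h
  · obtain ⟨g, hg⟩ := MulAction.exists_smul_eq (Perm (Fin 5)) (e.symm i) (e.symm j)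
    refine ⟨φ g, ⟨g, rfl⟩, ?_⟩
    change e (g • e.symm i) = j
    rw [hg, e.apply_symm_apply]

/-- `S_6` has an automorphism that is not inner. -/
theorem exists_not_isInnerAut_six :
    ∃ e : MulAut (Perm (Fin 6)), e ∉ (MulAut.conj (G := Perm (Fin 6))).range := by
  obtain ⟨H, hH, htr⟩ := exists_transitive_subgroup_index_six
  have hc : Nat.card (Perm (Fin 6) ⧸ H) = 6 := hH
  let e : Perm (Fin 6) ⧸ H ≃ Fin 6 := Finite.equivFinOfCardEq hc
  let ψ : Perm (Fin 6) →* Perm (Fin 6) :=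
    e.permCongrHom.toMonoidHom.comp (MulAction.toPermHom (Perm (Fin 6)) (Perm (Fin 6) ⧸ H))
  have hψ : Function.Injective ψ := e.permCongrHom.injective.comp
    (toPermHom_injective_of_isPretransitive (by simp) (by omega))
  refine ⟨MulEquiv.ofBijective ψ (Finite.injective_iff_bijective.mp hψ), ?_⟩
  rintro ⟨g, hg⟩
  have hconj : ∀ σ, ψ σ = g * σ * g⁻¹ := fun σ => (DFunLike.congr_fun hg σ).symm
  -- `p` is the trivial coset, fixed by `ψ σ` for `σ ∈ H`. Were `ψ` conjugation by `g`, all of `H`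
  -- would fix `g⁻¹ p`, against transitivity.
  let p : Fin 6 := e (1 : Perm (Fin 6))
  obtain ⟨q, hq⟩ : ∃ q, q ≠ g⁻¹ p := exists_ne _
  obtain ⟨σ, hσ, hσq⟩ := htr (g⁻¹ p) q
  have hfix : ψ σ p = p := by
    change e (σ • e.symm (e (1 : Perm (Fin 6)))) = e (1 : Perm (Fin 6))
    rw [e.symm_apply_apply, MulAction.Quotient.smul_coe, smul_eq_mul, mul_one]
    congr 1
    rw [QuotientGroup.eq]
    simpa using hσ
  rw [hconj, Perm.mul_apply, Perm.mul_apply, hσq] at hfix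
  exact hq (by rw [← hfix]; simp)

/-! ### Inner automorphisms and `Out(S_6)` -/

theorem mem_range_conj_iff_isInnerAut {G : Type*} [Group G] (e : MulAut G) :
    e ∈ (MulAut.conj (G := G)).range ↔ IsInnerAut e.toMonoidHom := by
  constructor
  · rintro ⟨g, rfl⟩
    exact ⟨g, fun x => rfl⟩
  · rintro ⟨g, hg⟩
    exact ⟨g, MulEquiv.ext fun x => (hg x).symm⟩

/-- Transpositions form one conjugacy class, so testing a single one suffices. -/
theorem mem_range_conj_of_isSwap {α : Type*} [Fintype α] [DecidableEq α]
    (h3 : 3 ≤ Fintype.card α) (e : MulAut (Perm α)) {s : Perm α} (hs : s.IsSwap)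
    (hes : (e s).IsSwap) : e ∈ (MulAut.conj (G := Perm α)).range := by
  rw [mem_range_conj_iff_isInnerAut]
  refine isInnerAut_of_isSwap_map h3 e.injective fun t ht => ?_
  have hst : IsConj s t := by
    rw [isConj_iff_cycleType_eq, isSwap_iff_cycleType.mp hs, isSwap_iff_cycleType.mp ht]
  have h := isConj_iff_cycleType_eq.mp (e.toMonoidHom.map_isConj hst)
  rw [isSwap_iff_cycleType] at hes ⊢
  exact h.symm.trans hes

/-- An automorphism of `S_n` is inner if `n ≥ 5` and `n ≠ 6`. -/
theorem mem_range_conj_of_card_ne_six {α : Type*} [Fintype α] [DecidableEq α]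
    (h5 : 5 ≤ Fintype.card α) (h6 : Fintype.card α ≠ 6) (e : MulAut (Perm α)) :
    e ∈ (MulAut.conj (G := Perm α)).range := by
  have : Nontrivial α := Fintype.one_lt_card_iff_nontrivial.mp (by omega)
  obtain ⟨a, b, hab⟩ := exists_pair_ne α
  have hs : (swap a b).IsSwap := ⟨a, b, hab, rfl⟩
  exact mem_range_conj_of_isSwap (by omega) e hs
    ((cycleType_mulAut_swap h5 e hs).resolve_right fun h => h6 h.1)

/-- The composite of two outer automorphisms of `S_6` is inner. -/
theorem inv_mul_mem_range_conj_six {a b : MulAut (Perm (Fin 6))}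
    (ha : a ∉ (MulAut.conj (G := Perm (Fin 6))).range)
    (hb : b ∉ (MulAut.conj (G := Perm (Fin 6))).range) :
    a⁻¹ * b ∈ (MulAut.conj (G := Perm (Fin 6))).range := by
  have hs : (swap (0 : Fin 6) 1).IsSwap := ⟨0, 1, by decide, rfl⟩
  have ha' := (cycleType_mulAut_swap (by simp) a hs).resolve_left
    fun h => ha (mem_range_conj_of_isSwap (by simp) a hs h)
  have hb' := (cycleType_mulAut_swap (by simp) b hs).resolve_left
    fun h => hb (mem_range_conj_of_isSwap (by simp) b hs h)
  -- Applying `a⁻¹` to this conjugacy shows that `a⁻¹ * b` sends `(0 1)` to a conjugate of itself.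
  have hconj : IsConj (a (swap 0 1)) (b (swap 0 1)) := by
    rw [isConj_iff_cycleType_eq, ha'.2, hb'.2]
  refine mem_range_conj_of_isSwap (by simp) _ hs ?_
  have h := isConj_iff_cycleType_eq.mp 
    ((a⁻¹ : MulAut (Perm (Fin 6))).toMonoidHom.map_isConj hconj)
  rw [isSwap_iff_cycleType] at hs ⊢
  rw [← hs]
  refine h.symm.trans (congrArg cycleType ?_)
  exact MulAut.inv_apply_self (Perm (Fin 6)) a (swap 0 1)

theorem index_range_conj_six : (MulAut.conj (G := Perm (Fin 6))).range.index = 2 := by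
  obtain ⟨a, ha⟩ := exists_not_isInnerAut_six
  rw [Subgroup.index_eq_two_iff']
  refine ⟨a⁻¹, fun b => ?_⟩
  by_cases hb : b ∈ (MulAut.conj (G := Perm (Fin 6))).range
  · refine Or.inr ⟨hb, fun h => ha ?_⟩
    rwa [Subgroup.mul_mem_cancel_right _ hb, inv_mem_iff] at h
  · exact Or.inl ⟨inv_mul_mem_range_conj_six ha hb, hb⟩

theorem nonempty_out_six_mulEquiv :
    Nonempty (Out (Perm (Fin 6)) ≃* Multiplicative (ZMod 2)) := by
  have : Fact (Nat.Prime 2) := ⟨Nat.prime_two⟩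
  have h : Nat.card (Out (Perm (Fin 6))) = 2 := index_range_conj_six
  exact ⟨mulEquivOfPrimeCardEq h (by simp)⟩

theorem bijective_of_not_isCyclic_range {α : Type*} [Fintype α] [DecidableEq α]
    (h5 : 5 ≤ Fintype.card α) (f : Perm α →* Perm α) (hf : ¬ IsCyclic f.range) :
    Function.Bijective f :=
  Finite.injective_iff_bijective.mp (injective_of_not_isCyclic_range h5 f hf)

theorem theorem1p3 :
    (∀ (n m : ℕ), 2 < m → m < n → (n, m) ≠ (4, 3) →
      ∀ f : Equiv.Perm (Fin n) →* Equiv.Perm (Fin m), IsCyclic f.range) ∧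
    (∀ (n : ℕ), 2 < n → n ≠ 4 → n ≠ 6 →
      ∀ f : Equiv.Perm (Fin n) →* Equiv.Perm (Fin n), ¬ IsCyclic f.range → IsInnerAut f) ∧
    ((∀ f : Equiv.Perm (Fin 6) →* Equiv.Perm (Fin 6),
        ¬ IsCyclic f.range → Function.Bijective f) ∧
      Nonempty (Out (Equiv.Perm (Fin 6)) ≃* Multiplicative (ZMod 2))) ∧
    (∀ f : Equiv.Perm (Fin 4) →* Equiv.Perm (Fin 3),
      ¬ IsCyclic f.range → IsConjHom f exceptionalHom) ∧
    (∀ f : Equiv.Perm (Fin 4) →* Equiv.Perm (Fin 4),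
      ¬ IsCyclic f.range → IsInnerAut f ∨ IsConjHom f (inclS3S4.comp exceptionalHom)) := by
  refine ⟨fun n m hm hmn hne f => ?_, fun n h2 h4 h6 f hf => ?_,
    ⟨fun f hf => bijective_of_not_isCyclic_range (by simp) f hf, nonempty_out_six_mulEquiv⟩,
    fun f hf => hom_perm_four_three hf, fun f hf => hom_perm_four_four hf⟩
  · by_contra hf
    have h5 : 5 ≤ n := by
      -- `2 < m < n ≤ 4` leaves only the excluded pair `(4, 3)`.
      by_contra hn
      exact hne (Prod.ext (by simp; omega) (by simp; omega))
    have hinj := injective_of_not_isCyclic_range (by simpa using h5) f hf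
    have hle := Nat.card_le_card_of_injective f hinj
    rw [Nat.card_perm, Nat.card_perm, Nat.card_fin, Nat.card_fin] at hle
    exact absurd hle (not_le.mpr ((Nat.factorial_lt (by omega)).mpr hmn))
  · obtain rfl | h5 : n = 3 ∨ 5 ≤ n := by omega
    · exact hom_perm_three hf
    · have hbij := bijective_of_not_isCyclic_range (by simpa using h5) f hf
      exact (mem_range_conj_iff_isInnerAut (MulEquiv.ofBijective f hbij)).mp
        (mem_range_conj_of_card_ne_six (by simpa using h5) (by simpa using h6) _)
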